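/- Let $\varphi:\mathbb R\to\mathbb C$ and let $$A(\mathbb R)=\Big\{h:\mathbb R\to\mathbb C:\ h(x)=\int_{-\infty}^{\infty}g(t)e^{-itx}\,dt\ \ (x\in\mathbb R)\ \text{ for some } g\in L_1(\mathbb R)\Big\}$$ be the Wiener algebra of absolutely convergent Fourier integrals. Suppose that $\varphi$ has bounded variation in some neighbourhood of $0$, $\varphi(0)=1$, the function $x\varphi(x)$ belongs to $L_1(\mathbb R)$, $\varphi\in A(\mathbb R)$, $\varphi$ is differentiable at every $x\neq 0$, and the function $x\varphi'(x)$ (with value $0$ at $x=0$) belongs to $A(\mathbb R)\cap L_1(\mathbb R)$. Let $f:\mathbb R\to\mathbb C$ be any $2\pi$-periodic function integrable on $[-\pi,\pi]$, with Fourier coefficients $\widehat f_k=\frac1{2\pi}\int_{-\pi}^{\pi}f(t)e^{-ikt}\,dt$, and let $x\in\mathbb R$ be any $d$-point of $f$, that is, a point at which $F(y)=\int_0^y f(t)\,dt$ is differentiable; put $d_f(x)=F'(x)$. Then for every $n\ge 0$ the series below converges absolutely, and $$\lim_{n\to\infty}\ \sum_{k=-\infty}^{+\infty}\varphi\Big(\frac{k}{n+1}\Big)\widehat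 f_k\,e^{ikx}=d_f(x).$$ -/

import Mathlib

open Filter Topology MeasureTheory

/-- Membership in the Wiener algebra `A(ℝ)` of absolutely convergent Fourier integrals:
`φ(x) = ∫ g(t) e^{-itx} dt` for every real `x`, with some `g ∈ L₁(ℝ)`. -/
def InWienerAlgebra (φ : ℝ → ℂ) : Prop :=
  ∃ g : ℝ → ℂ, Integrable g volume ∧
    ∀ x : ℝ, φ x = ∫ t : ℝ, g t * Complex.exp (-(Complex.I * (t : ℂ) * (x : ℂ)))

/-- `f ∈ L₁(𝕋)`: a `2π`-periodic function on the line that is Lebesgue integrable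
over `[-π, π]`. -/
def InL1Torus (f : ℝ → ℂ) : Prop :=
  Function.Periodic f (2 * Real.pi) ∧
    IntervalIntegrable f volume (-Real.pi) Real.pi

/-- The Fourier coefficient `(1 / 2π) ∫_{-π}^{π} f(t) e^{-ikt} dt`. -/
noncomputable def torusCoeff (f : ℝ → ℂ) (k : ℤ) : ℂ :=
  (1 / (2 * (Real.pi : ℂ))) *
    ∫ t in (-Real.pi)..Real.pi, f t * Complex.exp (-(Complex.I * (k : ℂ) * (t : ℂ)))

/-- `x` is a `d`-point of `f` with value `d = d_f(x)`: the function `F(y) = ∫_0^y f(t) dt` is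
differentiable at `x`, with derivative `d`. -/
def IsDPoint (f : ℝ → ℂ) (x : ℝ) (d : ℂ) : Prop :=
  HasDerivAt (fun y : ℝ => ∫ t in (0 : ℝ)..y, f t) d x

/-- The `k`-th term `φ(k / (n + 1)) f̂_k e^{ikx}` of the `n`-th linear mean of the Fourier
series of `f` at `x`. -/
noncomputable def meanTerm (φ f : ℝ → ℂ) (n : ℕ) (x : ℝ) (k : ℤ) : ℂ :=
  φ ((k : ℝ) / ((n : ℝ) + 1)) * torusCoeff f k *
    Complex.exp (Complex.I * (k : ℂ) * (x : ℂ))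

open scoped FourierTransform ContDiff

/-! Let `G = 𝓕 φ`. Poisson summation, integrated against `f`, turns the mean into `∫ G(u) f(x +
2πu/N) du` with `N = n + 1` (`tsum_meanTerm_eq_integral`), and inversion gives `∫ G = φ(0) = 1`. It
remains to show that `∫ G(u) q(u/N) du` tends to `0` for `q(v) = f(x + 2πv) - d`.

At a `d`-point `q` need not be small, even on average of `|q|`; only its primitive `P` is, with
`P(s) = o(s)` at `0`. Integration by parts gives `-∫ G'(s) N P(s/N) ds` on the half line. Here `N
P(s/N)` tends to `0` pointwise and is at most `C|s|`, so dominated convergence applies once `s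
G'(s)` is integrable. That is what the conditions on `φ` supply: up to sign `s G'(s)` is the
transform of `(xφ)' = φ + xφ'`, and an integrable member of the Wiener algebra has an integrable
transform (`integrable_id_mul_deriv_fourier`). -/

/-! ### Fourier inversion and the Wiener algebra -/

theorem fourierInv_fourier_ae_eq {g : ℝ → ℂ} (hg : Integrable g) (hg' : Integrable (𝓕 g)) :
    𝓕⁻ (𝓕 g) =ᵐ[volume] g := by
  have flip {u v : ℝ → ℂ} (hu : Integrable u) (hv : Integrable v) :
      ∫ ξ, 𝓕 u ξ * v ξ = ∫ ξ, u ξ * 𝓕 v ξ := by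
    simpa using! VectorFourier.integral_fourierIntegral_smul_eq_flip (L := innerₗ ℝ)
      Real.continuous_fourierChar continuous_inner hu hv
  have hneg : Integrable fun x => 𝓕 g (-x) := hg'.comp_neg
  have hcont : Continuous (𝓕⁻ (𝓕 g)) := by
    rw [Real.fourierInv_eq_fourier_comp_neg]
    exact VectorFourier.fourierIntegral_continuous Real.continuous_fourierChar
      (L := innerₗ ℝ) continuous_inner hneg
  -- As `g` need not be continuous, the identity is tested against smooth `χ`: both transforms are
  -- moved onto `χ`, where Schwartz inversion applies.
  refine ae_eq_of_integral_contDiff_smul_eq hcont.locallyIntegrable hg.locallyIntegrable ?_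
  intro χ hχ hχs
  have hχ' : ContDiff ℝ ∞ (fun x => (χ x : ℂ)) := Complex.ofRealCLM.contDiff.comp hχ
  have hχs' : HasCompactSupport (fun x => (χ x : ℂ)) := hχs.comp_left Complex.ofReal_zero
  let X : SchwartzMap ℝ ℂ := hχs'.toSchwartzMap hχ'
  have hX : ∀ x, X x = (χ x : ℂ) := fun x => rfl
  let Y : SchwartzMap ℝ ℂ := 𝓕⁻ X
  have hY : 𝓕 Y = X := FourierTransform.fourier_fourierInv_eq X
  have hY1 : 𝓕 (Y : ℝ → ℂ) = X := by rw [← SchwartzMap.fourier_coe, hY]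
  have hY2 : (Y : ℝ → ℂ) = 𝓕⁻ (X : ℝ → ℂ) := SchwartzMap.fourierInv_coe X
  calc ∫ x, χ x • 𝓕⁻ (𝓕 g) x = ∫ x, X x * 𝓕 (fun y => 𝓕 g (-y)) x := by
        rw [Real.fourierInv_eq_fourier_comp_neg]; simp [hX]
    _ = ∫ x, 𝓕 (X : ℝ → ℂ) x * 𝓕 g (-x) := (flip X.integrable hneg).symm
    _ = ∫ x, 𝓕 (X : ℝ → ℂ) (-x) * 𝓕 g x := by
        rw [← integral_neg_eq_self]; simp
    _ = ∫ x, Y x * 𝓕 g x := by simp_rw [hY2, Real.fourierInv_eq_fourier_neg]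
    _ = ∫ x, 𝓕 (Y : ℝ → ℂ) x * g x := (flip Y.integrable hg).symm
    _ = ∫ x, χ x • g x := by rw [hY1]; simp [hX]

theorem InWienerAlgebra.exists_eq_fourier {φ : ℝ → ℂ} (h : InWienerAlgebra φ) :
    ∃ g : ℝ → ℂ, Integrable g ∧ φ = 𝓕 g := by
  obtain ⟨g, hg, hφ⟩ := h
  have hpi : (2 * Real.pi) ≠ 0 := by positivity
  -- The substitution `t = 2πu` passes from the kernel `e^{-itx}` to `e^{-2πiux}`.
  refine ⟨fun u => (2 * Real.pi : ℂ) * g (2 * Real.pi * u),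
    (hg.comp_mul_left' hpi).const_mul _, ?_⟩
  ext x
  rw [hφ, Real.fourier_real_eq_integral_exp_smul]
  have key := Measure.integral_comp_mul_left
    (fun t : ℝ => g t * Complex.exp (-(Complex.I * (t : ℂ) * (x : ℂ)))) (2 * Real.pi)
  have h2 : (2 * Real.pi : ℂ) ≠ 0 := by exact_mod_cast hpi
  rw [abs_of_pos (by positivity), Complex.real_smul, Complex.ofReal_inv, Complex.ofReal_mul,
    Complex.ofReal_ofNat, eq_inv_mul_iff_mul_eq₀ h2, ← integral_const_mul] at key
  rw [← key]
  congr 1 with u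
  rw [smul_eq_mul, mul_comm (Complex.exp _), mul_assoc]
  have : -(Complex.I * ↑(2 * Real.pi * u) * ↑x) = ↑(-2 * Real.pi * u * x) * Complex.I := by
    push_cast
    ring
  rw [this]
  ring

theorem continuous_fourier {g : ℝ → ℂ} (hg : Integrable g) : Continuous (𝓕 g) :=
  VectorFourier.fourierIntegral_continuous Real.continuous_fourierChar
    (L := innerₗ ℝ) continuous_inner hg

theorem InWienerAlgebra.continuous {φ : ℝ → ℂ} (h : InWienerAlgebra φ) : Continuous φ := by
  obtain ⟨g, hg, rfl⟩ := h.exists_eq_fourier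
  exact continuous_fourier hg

/-- If `φ = 𝓕 g`, inversion shows that `𝓕 φ` is a.e. the reflection of the integrable `g`. -/
theorem InWienerAlgebra.integrable_fourier {φ : ℝ → ℂ} (h : InWienerAlgebra φ)
    (hφ : Integrable φ) : Integrable (𝓕 φ) := by
  obtain ⟨g, hg, rfl⟩ := h.exists_eq_fourier
  have := (hg.congr (fourierInv_fourier_ae_eq hg hφ).symm).comp_neg
  simpa [Real.fourierInv_eq_fourier_neg] using this

/-! ### Decay of the kernel and its derivative -/

theorem Continuous.integrable_of_integrable_id_mul {φ : ℝ → ℂ} (hc : Continuous φ)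
    (h : Integrable fun x : ℝ => (x : ℂ) * φ x) : Integrable φ := by
  have h1 : Integrable ((Set.Icc (-1 : ℝ) 1).indicator φ) :=
    (hc.integrableOn_Icc).integrable_indicator measurableSet_Icc
  refine (h1.norm.add h.norm).mono' hc.aestronglyMeasurable (ae_of_all _ fun x => ?_)
  simp only [Pi.add_apply]
  by_cases hx : x ∈ Set.Icc (-1 : ℝ) 1
  · rw [Set.indicator_of_mem hx]
    exact le_add_of_nonneg_right (norm_nonneg _)
  · rw [Set.indicator_of_notMem hx, norm_zero, zero_add, norm_mul, Complex.norm_real]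
    refine le_mul_of_one_le_left (norm_nonneg _) ?_
    by_contra! hlt
    exact hx (abs_le.1 hlt.le)

/-- The product rule for `x φ(x)`, including the origin, where only continuity of `φ` is used. -/
theorem hasDerivAt_id_mul {φ : ℝ → ℂ} (hc : Continuous φ)
    (hdiff : ∀ x : ℝ, x ≠ 0 → DifferentiableAt ℝ φ x) (x : ℝ) :
    HasDerivAt (fun x : ℝ => (x : ℂ) * φ x) (φ x + x * deriv φ x) x := by
  rcases eq_or_ne x 0 with rfl | hx
  · rw [hasDerivAt_iff_tendsto_slope_zero]
    have : Tendsto φ (𝓝[≠] 0) (𝓝 (φ 0)) := hc.continuousAt.tendsto.mono_left nhdsWithin_le_nhds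
    simp only [zero_add, Complex.ofReal_zero, zero_mul, add_zero, sub_zero]
    refine this.congr' ?_
    filter_upwards [self_mem_nhdsWithin] with t ht
    have : (t : ℂ) ≠ 0 := by exact_mod_cast ht
    rw [Complex.real_smul, Complex.ofReal_inv, inv_mul_cancel_left₀ this]
  · have h1 : HasDerivAt (fun x : ℝ => (x : ℂ)) 1 x := Complex.ofRealCLM.hasDerivAt
    simpa using! h1.mul (hdiff x hx).hasDerivAt

/-- With `G = 𝓕 φ` the function in question is `y G'(y) = -𝓕((xφ)')(y)`, and both summands of `(xφ)'
= φ + xφ'` are integrable members of the Wiener algebra. -/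
theorem integrable_id_mul_deriv_fourier {φ : ℝ → ℂ}
    (hL1 : Integrable (fun x : ℝ => (x : ℂ) * φ x))
    (hA : InWienerAlgebra φ)
    (hdiff : ∀ x : ℝ, x ≠ 0 → DifferentiableAt ℝ φ x)
    (hdA : InWienerAlgebra (fun x : ℝ => (x : ℂ) * deriv φ x))
    (hdL1 : Integrable (fun x : ℝ => (x : ℂ) * deriv φ x)) :
    Integrable fun y : ℝ => (y : ℂ) * 𝓕 (fun x : ℝ => (-2 * Real.pi * Complex.I * x) • φ x) y := by
  have hφ := hA.continuous.integrable_of_integrable_id_mul hL1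
  have hd : ∀ x, HasDerivAt (fun x : ℝ => (x : ℂ) * φ x) (φ x + x * deriv φ x) x :=
    hasDerivAt_id_mul hA.continuous hdiff
  have hde : deriv (fun x : ℝ => (x : ℂ) * φ x) = fun x => φ x + x * deriv φ x :=
    funext fun x => (hd x).deriv
  have key := Real.fourier_deriv hL1 (fun x => (hd x).differentiableAt)
    (by rw [hde]; exact hφ.add hdL1)
  have hint : Integrable (𝓕 (deriv fun x : ℝ => (x : ℂ) * φ x)) := by
    rw [hde]
    have : 𝓕 (fun x : ℝ => φ x + x * deriv φ x) =
        fun y => 𝓕 φ y + 𝓕 (fun x : ℝ => (x : ℂ) * deriv φ x) y := by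
      ext y
      exact congrFun (VectorFourier.fourierIntegral_add Real.continuous_fourierChar
        (L := innerₗ ℝ) continuous_inner hφ hdL1) y
    rw [this]
    exact (hA.integrable_fourier hφ).add (hdA.integrable_fourier hdL1)
  refine hint.neg.congr (ae_of_all _ fun y => ?_)
  have : 𝓕 (fun x : ℝ => (-2 * Real.pi * Complex.I * x) • φ x) y
      = (-2 * Real.pi * Complex.I) * 𝓕 (fun x : ℝ => (x : ℂ) * φ x) y := by
    simp only [Real.fourier_real_eq_integral_exp_smul, ← integral_const_mul]
    congr 1 with u
    simp only [smul_eq_mul]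
    ring
  rw [Pi.neg_apply, key]
  beta_reduce
  rw [this, smul_eq_mul]
  ring

theorem fourier_fourier_eq {φ : ℝ → ℂ} (hA : InWienerAlgebra φ) (hφ : Integrable φ) (x : ℝ) :
    𝓕 (𝓕 φ) x = φ (-x) := by
  have := congrFun (hA.continuous.fourierInv_fourier_eq hφ (hA.integrable_fourier hφ)) (-x)
  rwa [Real.fourierInv_eq_fourier_neg, neg_neg] at this

/-! ### Integration by parts and the limit -/

/-- Integration by parts on a half line against a merely locally integrable function `q`
whose absolute primitive grows at most linearly. -/
theorem integrableOn_mul_and_integral_eq_of_primitive_le {G G' q : ℝ → ℂ} {C : ℝ}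
    (hG : ∀ x, HasDerivAt G (G' x) x) (hc : Continuous G')
    (hI : IntegrableOn (fun s : ℝ => (s : ℂ) * G' s) (Set.Ioi 0))
    (hlim : Tendsto G atTop (𝓝 0)) (hq : ∀ a b, IntervalIntegrable q volume a b)
    (hC : ∀ s, 0 ≤ s → ∫ u in (0 : ℝ)..s, ‖q u‖ ≤ C * (1 + s)) :
    IntegrableOn (fun u => G u * q u) (Set.Ioi 0) ∧
      ∫ u in Set.Ioi 0, G u * q u = -∫ s in Set.Ioi 0, G' s * ∫ u in (0 : ℝ)..s, q u := by
  set μ := volume.restrict (Set.Ioi (0 : ℝ)) with hμ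
  have hG'int : IntegrableOn G' (Set.Ioi 0) := by
    rw [← Set.Ioc_union_Ioi_eq_Ioi zero_le_one]
    refine (hc.integrableOn_Ioc).union ?_
    refine Integrable.mono' (hI.mono_set (Set.Ioi_subset_Ioi zero_le_one)).norm
      hc.aestronglyMeasurable ((ae_restrict_iff' measurableSet_Ioi).2 (ae_of_all _ fun x hx => ?_))
    rw [norm_mul, Complex.norm_real]
    exact le_mul_of_one_le_left (norm_nonneg _) (hx.le.trans (le_abs_self x))
  have hqm : AEStronglyMeasurable q μ := by
    have : LocallyIntegrable q := by
      rw [locallyIntegrable_iff]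
      intro K hK
      obtain ⟨R, hR⟩ := hK.isBounded.subset_closedBall 0
      rw [Real.closedBall_eq_Icc] at hR
      have h := hq (0 - R) (0 + R)
      by_cases hR0 : 0 - R ≤ 0 + R
      · rw [intervalIntegrable_iff_integrableOn_Icc_of_le hR0] at h
        exact h.mono_set hR
      · rw [Set.Icc_eq_empty hR0] at hR
        rw [Set.subset_empty_iff.1 hR]
        exact integrableOn_empty
    exact this.aestronglyMeasurable.restrict
  let T : Set (ℝ × ℝ) := {p | p.1 < p.2}
  have hT : MeasurableSet T := measurableSet_lt measurable_fst measurable_snd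
  -- Fubini on the triangle `0 < u < s`: integrating in `s` first gives `-G(u) q(u)`, in `u` first
  -- gives `G'(s) ∫_0^s q`. Integrability of `K` also yields that of `G q`.
  let K : ℝ → ℝ → ℂ := fun u s => (Set.Iio s).indicator (fun u => G' s * q u) u
  have hK' : ∀ u s, K u s = (Set.Ioi u).indicator (fun s => G' s * q u) s := fun u s => by
    simp [K, Set.indicator]
  have hKT : Function.uncurry K = T.indicator (fun p => G' p.2 * q p.1) := by
    ext ⟨u, s⟩
    simp [K, T, Set.indicator]
  have hKm : AEStronglyMeasurable (Function.uncurry K) (μ.prod μ) := by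
    rw [hKT]
    exact ((hc.comp continuous_snd).aestronglyMeasurable.mul hqm.comp_fst).indicator hT
  have hcol : ∀ s : ℝ, 0 < s → ∀ F : ℝ → ℂ,
      ∫ u, (Set.Iio s).indicator F u ∂μ = ∫ u in (0 : ℝ)..s, F u := fun s hs F => by
    rw [integral_indicator measurableSet_Iio, Measure.restrict_restrict measurableSet_Iio,
      Set.Iio_inter_Ioi, intervalIntegral.integral_of_le hs.le, integral_Ioc_eq_integral_Ioo]
  have hcolR : ∀ s : ℝ, 0 < s → ∀ F : ℝ → ℝ,
      ∫ u, (Set.Iio s).indicator F u ∂μ = ∫ u in (0 : ℝ)..s, F u := fun s hs F => by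
    rw [integral_indicator measurableSet_Iio, Measure.restrict_restrict measurableSet_Iio,
      Set.Iio_inter_Ioi, intervalIntegral.integral_of_le hs.le, integral_Ioc_eq_integral_Ioo]
  have hpos : ∀ᵐ s ∂μ, 0 < s := ae_restrict_mem measurableSet_Ioi
  have hKint : Integrable (Function.uncurry K) (μ.prod μ) := by
    rw [integrable_prod_iff' hKm]
    constructor
    · filter_upwards [hpos] with s hs
      change Integrable ((Set.Iio s).indicator (fun u => G' s * q u)) μ
      rw [integrable_indicator_iff measurableSet_Iio, IntegrableOn, hμ,
        Measure.restrict_restrict measurableSet_Iio, Set.Iio_inter_Ioi]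
      refine Integrable.const_mul ?_ _
      exact ((intervalIntegrable_iff_integrableOn_Ioo_of_le hs.le).1 (hq 0 s))
    · have hbound : Integrable (fun s => C * (‖G' s‖ + ‖(s : ℂ) * G' s‖)) μ :=
        (hG'int.norm.add hI.norm).const_mul C
      refine hbound.mono' hKm.norm.prod_swap.integral_prod_right' ?_
      filter_upwards [hpos] with s hs
      have h1 : ∀ u, ‖Function.uncurry K (u, s)‖
          = (Set.Iio s).indicator (fun u => ‖G' s‖ * ‖q u‖) u := fun u => by
        change ‖(Set.Iio s).indicator (fun u => G' s * q u) u‖ = _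
        rw [norm_indicator_eq_indicator_norm]
        simp only [norm_mul]
      have h2 : ∫ u, ‖Function.uncurry K (u, s)‖ ∂μ = ‖G' s‖ * ∫ u in (0 : ℝ)..s, ‖q u‖ := by
        simp_rw [h1]
        rw [hcolR s hs, intervalIntegral.integral_const_mul]
      have h3 : 0 ≤ ∫ u in (0 : ℝ)..s, ‖q u‖ :=
        intervalIntegral.integral_nonneg hs.le fun u _ => norm_nonneg _
      rw [h2, Real.norm_of_nonneg (by positivity), norm_mul, Complex.norm_real,
        Real.norm_of_nonneg hs.le]
      calc ‖G' s‖ * ∫ u in (0 : ℝ)..s, ‖q u‖ ≤ ‖G' s‖ * (C * (1 + s)) := by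
            gcongr
            exact hC s hs.le
        _ = C * (‖G' s‖ + s * ‖G' s‖) := by ring
  have hrow : ∀ u : ℝ, 0 < u → ∫ s, K u s ∂μ = -(G u * q u) := fun u hu => by
    simp_rw [hK']
    rw [integral_indicator measurableSet_Ioi, hμ, Measure.restrict_restrict measurableSet_Ioi,
      Set.Ioi_inter_Ioi, sup_eq_left.2 hu.le, integral_mul_const,
      integral_Ioi_of_hasDerivAt_of_tendsto (hG u).continuousAt.continuousWithinAt
        (fun x _ => hG x) (hG'int.mono_set (Set.Ioi_subset_Ioi hu.le)) hlim]
    ring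
  have hrow' : (fun u => ∫ s, K u s ∂μ) =ᵐ[μ] fun u => -(G u * q u) := by
    filter_upwards [hpos] with u hu using hrow u hu
  have hint : Integrable (fun u => G u * q u) μ := by
    have := (hKint.integral_prod_left.congr hrow').neg
    simpa using! this
  refine ⟨hint, ?_⟩
  have hswap := integral_integral_swap hKint
  rw [integral_congr_ae hrow', integral_neg, neg_eq_iff_eq_neg] at hswap
  rw [hswap]
  congr 1
  refine integral_congr_ae ?_
  filter_upwards [hpos] with s hs
  change ∫ u, (Set.Iio s).indicator (fun u => G' s * q u) u ∂μ = _
  rw [hcol s hs, intervalIntegral.integral_const_mul]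

theorem Function.Periodic.intervalIntegral_norm_le {q : ℝ → ℂ} (hp : Function.Periodic q 1)
    (hq : ∀ a b, IntervalIntegrable q volume a b) {s : ℝ} (hs : 0 ≤ s) :
    ∫ u in (0 : ℝ)..s, ‖q u‖ ≤ (∫ u in (0 : ℝ)..1, ‖q u‖) * (1 + s) := by
  have hp' : Function.Periodic (fun u => ‖q u‖) 1 := fun u => by simp only [hp u]
  have h1 : ∫ u in (0 : ℝ)..s, ‖q u‖ ≤ ∫ u in (0 : ℝ)..(⌈s⌉₊ : ℝ), ‖q u‖ :=
    intervalIntegral.integral_mono_interval le_rfl hs (Nat.le_ceil s)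
      (ae_of_all _ fun u => norm_nonneg _) (hq _ _).norm
  have h2 := hp'.intervalIntegral_add_zsmul_eq ⌈s⌉₊ 0 fun a b => (hq a b).norm
  simp only [zero_add, natCast_zsmul, nsmul_eq_mul, mul_one] at h2
  have h3 : 0 ≤ ∫ u in (0 : ℝ)..1, ‖q u‖ :=
    intervalIntegral.integral_nonneg zero_le_one fun u _ => norm_nonneg _
  have h4 : (⌈s⌉₊ : ℝ) ≤ 1 + s := by linarith [Nat.ceil_lt_add_one hs]
  rw [h2] at h1
  nlinarith

theorem tendsto_setIntegral_Ioi_mul_periodic {G G' q : ℝ → ℂ}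
    (hG : ∀ x, HasDerivAt G (G' x) x) (hc : Continuous G')
    (hI : IntegrableOn (fun s : ℝ => (s : ℂ) * G' s) (Set.Ioi 0))
    (hlim : Tendsto G atTop (𝓝 0)) (hp : Function.Periodic q 1)
    (hq : ∀ a b, IntervalIntegrable q volume a b)
    (hd : HasDerivAt (fun y => ∫ u in (0 : ℝ)..y, q u) 0 0) :
    (∀ n : ℕ, IntegrableOn (fun u => G u * q (u / (n + 1))) (Set.Ioi 0)) ∧
      Tendsto (fun n : ℕ => ∫ u in Set.Ioi 0, G u * q (u / (n + 1))) atTop (𝓝 0) := by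
  set M := ∫ u in (0 : ℝ)..1, ‖q u‖
  have hM0 : 0 ≤ M := intervalIntegral.integral_nonneg zero_le_one fun u _ => norm_nonneg _
  set P : ℝ → ℂ := fun y => ∫ u in (0 : ℝ)..y, q u
  have hN : ∀ n : ℕ, (0 : ℝ) < n + 1 := fun n => by positivity
  have key : ∀ n : ℕ, IntegrableOn (fun u => G u * q (u / (n + 1))) (Set.Ioi 0) ∧
      ∫ u in Set.Ioi 0, G u * q (u / (n + 1)) =
        -∫ s in Set.Ioi 0, G' s * ((n + 1 : ℝ) • P (s / (n + 1))) := fun n => by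
    have := integrableOn_mul_and_integral_eq_of_primitive_le (q := fun u => q (u / (n + 1)))
      -- This constant depends on `n` and serves only to justify the integration by parts; the bound
      -- uniform in `n` is the one on `P` below.
      (C := (n + 1) * M) hG hc hI hlim
      (fun a b => by
        have := (hq (a * (n + 1 : ℝ)⁻¹) (b * (n + 1 : ℝ)⁻¹)).comp_mul_right (c := (n + 1 : ℝ)⁻¹)
        have hne := inv_ne_zero (hN n).ne'
        rw [mul_div_cancel_right₀ _ hne, mul_div_cancel_right₀ _ hne] at this
        simpa only [← div_eq_mul_inv] using this)
      (fun s hs => by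
        rw [intervalIntegral.integral_comp_div (fun u => ‖q u‖) (hN n).ne', zero_div, smul_eq_mul,
          mul_assoc]
        refine mul_le_mul_of_nonneg_left ?_ (hN n).le
        refine (hp.intervalIntegral_norm_le hq (div_nonneg hs (hN n).le)).trans ?_
        refine mul_le_mul_of_nonneg_left ?_ hM0
        gcongr
        exact div_le_self hs (by simp))
    simpa only [intervalIntegral.integral_comp_div q (hN n).ne', zero_div] using this
  refine ⟨fun n => (key n).1, ?_⟩
  have hP0 : P 0 = 0 := intervalIntegral.integral_same
  obtain ⟨C, hC⟩ : ∃ C, ∀ s, 0 < s → ‖P s‖ ≤ C * s := by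
    have hsmall := (hasDerivAt_iff_isLittleO.1 hd).bound one_pos
    obtain ⟨δ, hδ, hball⟩ := Metric.eventually_nhds_iff.1 hsmall
    -- Below `δ` the zero derivative gives `‖P s‖ ≤ s`; from `δ` on, periodicity gives `M(1 + s)`,
    -- and `1 ≤ s/δ`.
    refine ⟨max 1 (M * (1 / δ + 1)), fun s hs => ?_⟩
    rcases lt_or_ge s δ with h | h
    · have := hball (y := s) (by simpa [abs_of_pos hs] using h)
      simp only [hP0, sub_zero, smul_zero, one_mul, Real.norm_eq_abs, abs_of_pos hs] at this
      exact this.trans (le_mul_of_one_le_left hs.le (le_max_left _ _))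
    · calc ‖P s‖ ≤ ∫ u in (0 : ℝ)..s, ‖q u‖ := intervalIntegral.norm_integral_le_integral_norm hs.le
        _ ≤ M * (1 + s) := hp.intervalIntegral_norm_le hq hs.le
        _ ≤ M * ((1 / δ + 1) * s) := by
            refine mul_le_mul_of_nonneg_left ?_ hM0
            have : 1 ≤ 1 / δ * s := by rw [one_div, inv_mul_eq_div]; exact (one_le_div hδ).2 h
            linarith
        _ ≤ _ := by
            rw [← mul_assoc]
            exact mul_le_mul_of_nonneg_right (le_max_right _ _) hs.le
  simp_rw [fun n => (key n).2]
  suffices h : Tendsto (fun n : ℕ => ∫ s in Set.Ioi 0, G' s * ((n + 1 : ℝ) • P (s / (n + 1))))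
      atTop (𝓝 0) by simpa using h.neg
  have hPc : Continuous P := intervalIntegral.continuous_primitive hq 0
  have hlim0 : ∫ s in Set.Ioi (0 : ℝ), (0 : ℂ) = 0 := by simp
  rw [← hlim0]
  refine tendsto_integral_of_dominated_convergence (fun s => C * ‖(s : ℂ) * G' s‖)
    (fun n => ?_) (hI.norm.const_mul C) (fun n => ?_) ?_
  · exact Continuous.aestronglyMeasurable
      (hc.mul ((hPc.comp (continuous_id.div_const (n + 1 : ℝ))).const_smul (n + 1 : ℝ)))
  · filter_upwards [ae_restrict_mem measurableSet_Ioi] with s (hs : 0 < s)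
    rw [norm_mul, norm_smul, norm_mul, Complex.norm_real, Real.norm_of_nonneg hs.le,
      Real.norm_of_nonneg (hN n).le]
    have := hC (s / (n + 1)) (div_pos hs (hN n))
    calc ‖G' s‖ * ((n + 1) * ‖P (s / (n + 1))‖) ≤ ‖G' s‖ * ((n + 1) * (C * (s / (n + 1)))) := by
          gcongr
      _ = C * (s * ‖G' s‖) := by
          have := (hN n).ne'
          field_simp
  · filter_upwards [ae_restrict_mem measurableSet_Ioi] with s (hs : 0 < s)
    have h1 : Tendsto (fun n : ℕ => s / ((n : ℝ) + 1)) atTop (𝓝[≠] 0) := by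
      refine tendsto_nhdsWithin_iff.2 ⟨?_, Eventually.of_forall fun n => (div_pos hs (hN n)).ne'⟩
      exact tendsto_const_nhds.div_atTop (tendsto_natCast_atTop_atTop.atTop_add tendsto_const_nhds)
    have h2 := (hasDerivAt_iff_tendsto_slope_zero.1 hd).comp h1
    have h3 := (h2.const_smul s).const_mul (G' s)
    rw [smul_zero, mul_zero] at h3
    refine h3.congr fun n => ?_
    simp only [Function.comp_apply, zero_add, hP0, sub_zero, smul_smul]
    congr 2
    have := (hN n).ne'
    field_simp

theorem tendsto_integral_mul_periodic {G G' q : ℝ → ℂ}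
    (hG : ∀ x, HasDerivAt G (G' x) x) (hc : Continuous G')
    (hI : Integrable (fun s : ℝ => (s : ℂ) * G' s))
    (hlim : Tendsto G (cocompact ℝ) (𝓝 0)) (hp : Function.Periodic q 1)
    (hq : ∀ a b, IntervalIntegrable q volume a b)
    (hd : HasDerivAt (fun y => ∫ u in (0 : ℝ)..y, q u) 0 0) :
    (∀ n : ℕ, Integrable (fun u => G u * q (u / (n + 1)))) ∧
      Tendsto (fun n : ℕ => ∫ u, G u * q (u / (n + 1))) atTop (𝓝 0) := by
  obtain ⟨p1, p2⟩ := tendsto_setIntegral_Ioi_mul_periodic hG hc hI.integrableOn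
    (hlim.mono_left atTop_le_cocompact) hp hq hd
  -- The negative half line is the positive one for the reflected data, which satisfy the same
  -- hypotheses.
  obtain ⟨m1, m2⟩ := tendsto_setIntegral_Ioi_mul_periodic (G := fun u => G (-u))
    (G' := fun u => -G' (-u)) (q := fun u => q (-u))
    (fun x => by simpa using! (hG (-x)).scomp x (hasDerivAt_neg x)) (hc.comp continuous_neg).neg
    (by simpa using! hI.comp_neg.integrableOn)
    ((hlim.mono_left atBot_le_cocompact).comp tendsto_neg_atTop_atBot)
    (fun u => by beta_reduce; rw [neg_add, ← sub_eq_add_neg, hp.sub_eq])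
    (fun a b => (IntervalIntegrable.iff_comp_neg (by simp)).2 (by simpa using! hq (-a) (-b)))
    (by
      simp_rw [intervalIntegral.integral_comp_neg, neg_zero,
        fun y : ℝ => intervalIntegral.integral_symm (f := q) (μ := volume) 0 (-y)]
      have := (HasDerivAt.scomp (h := fun y : ℝ => -y) (0 : ℝ) (by simpa using hd)
        (hasDerivAt_neg 0)).neg
      simpa using! this)
  have neg : ∀ n : ℕ, IntegrableOn (fun u => G u * q (u / (n + 1))) (Set.Iic 0) := fun n => by
    rw [integrableOn_Iic_iff_integrableOn_Iio,
      ← (Measure.measurePreserving_neg (volume : Measure ℝ)).integrableOn_comp_preimage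
        (Homeomorph.neg ℝ).measurableEmbedding]
    simpa [Function.comp_def, neg_div] using m1 n
  have int : ∀ n : ℕ, Integrable (fun u => G u * q (u / (n + 1))) := fun n => by
    rw [← integrableOn_univ, ← Set.Iic_union_Ioi (a := (0 : ℝ))]
    exact (neg n).union (p1 n)
  refine ⟨int, ?_⟩
  have := m2.add p2
  rw [add_zero] at this
  refine this.congr fun n => ?_
  rw [← intervalIntegral.integral_Iic_add_Ioi (neg n) (p1 n)]
  congr 1
  have := integral_comp_neg_Ioi (0 : ℝ) fun u => G u * q (u / (n + 1))
  rw [neg_zero] at this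
  rw [← this]
  simp only [neg_div]

/-! ### Sampling at integers and Poisson summation -/

theorem summable_intervalIntegral_int_window {F : ℝ → ℝ} (hF : Integrable F) (R : ℕ) :
    Summable fun n : ℤ => ∫ t in (n - R : ℝ)..(n + R + 1 : ℝ), F t := by
  have hs : Summable fun n : ℤ => ∫ t in (n : ℝ)..(n + 1 : ℝ), F t := by
    simpa using (hF.hasSum_intervalIntegral 0).summable
  have hj : ∀ j : ℕ, Summable fun n : ℤ =>
      ∫ t in ((n - R : ℝ) + (j : ℕ))..((n - R : ℝ) + (j + 1 : ℕ)), F t := fun j => by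
    have := (Equiv.addRight ((j : ℤ) - R)).summable_iff.2 hs
    refine this.congr fun n => ?_
    simp only [Function.comp_apply, Equiv.coe_addRight]
    push_cast
    congr 1 <;> ring
  -- Each window consists of `2R + 1` unit intervals, so the sum is a finite sum of shifted copies
  -- of `hs`.
  refine (summable_sum (s := Finset.range (2 * R + 1)) fun j _ => hj j).congr fun n => ?_
  rw [intervalIntegral.sum_integral_adjacent_intervals
    (a := fun j : ℕ => (n - R : ℝ) + (j : ℕ)) fun k _ => hF.intervalIntegrable]
  push_cast
  congr 1 <;> ring

/-- Average `‖h x‖ ≤ ‖h t‖ + ∫ ‖h'‖` over `t` in a unit interval inside `[a, b]`. -/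
theorem norm_le_integral_norm_add_integral_norm_deriv {h h' : ℝ → ℂ}
    (hd : ∀ x, HasDerivAt h (h' x) x) (hi : Integrable h) (hi' : Integrable h')
    {a b x y : ℝ} (hxa : a ≤ x) (hxb : x ≤ b) (hya : a ≤ y) (hyb : y + 1 ≤ b) :
    ‖h x‖ ≤ (∫ t in a..b, ‖h t‖) + ∫ t in a..b, ‖h' t‖ := by
  set D := ∫ t in a..b, ‖h' t‖
  have hosc : ∀ t ∈ Set.Icc y (y + 1), ‖h x‖ ≤ ‖h t‖ + D := fun t ht => by
    have h1 : h x - h t = ∫ s in t..x, h' s :=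
      (intervalIntegral.integral_eq_sub_of_hasDerivAt (fun s _ => hd s)
        hi'.intervalIntegrable).symm
    have h2 : ‖h x - h t‖ ≤ D := by
      rw [h1]
      refine (intervalIntegral.norm_integral_le_abs_integral_norm).trans ?_
      have hab : a ≤ b := hxa.trans hxb
      have hD : |D| = D :=
        abs_of_nonneg (intervalIntegral.integral_nonneg hab fun u _ => norm_nonneg (h' u))
      rw [← hD]
      refine intervalIntegral.abs_integral_mono_interval ?_ (ae_of_all _ fun u => norm_nonneg _)
        hi'.norm.intervalIntegrable
      exact Set.uIoc_subset_uIoc_of_uIcc_subset_uIcc (Set.uIcc_subset_uIcc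
        (Set.mem_uIcc_of_le (hya.trans ht.1) (ht.2.trans hyb)) (Set.mem_uIcc_of_le hxa hxb))
    calc ‖h x‖ = ‖h t + (h x - h t)‖ := by rw [add_sub_cancel]
      _ ≤ ‖h t‖ + ‖h x - h t‖ := norm_add_le _ _
      _ ≤ _ := by gcongr
  calc ‖h x‖ = ∫ _ in y..(y + 1), ‖h x‖ := by simp
    _ ≤ ∫ t in y..(y + 1), (‖h t‖ + D) :=
        intervalIntegral.integral_mono_on (by linarith) intervalIntegrable_const
          (hi.norm.intervalIntegrable.add intervalIntegrable_const) hosc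
    _ = (∫ t in y..(y + 1), ‖h t‖) + D := by
        rw [intervalIntegral.integral_add hi.norm.intervalIntegrable intervalIntegrable_const]
        simp
    _ ≤ _ := by
        gcongr
        exact intervalIntegral.integral_mono_interval hya (by linarith) hyb
          (ae_of_all _ fun u => norm_nonneg _) hi.norm.intervalIntegrable

/-- A function in the Sobolev space `W^{1,1}(ℝ)` has summable local suprema. -/
theorem summable_norm_restrict_comp_addRight {h : C(ℝ, ℂ)} {h' : ℝ → ℂ}
    (hd : ∀ x, HasDerivAt h (h' x) x) (hi : Integrable h) (hi' : Integrable h')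
    (K : TopologicalSpace.Compacts ℝ) :
    Summable fun n : ℤ => ‖(h.comp (ContinuousMap.addRight (n : ℝ))).restrict K‖ := by
  obtain ⟨r, hr⟩ := K.isCompact.isBounded.subset_closedBall 0
  obtain ⟨R, hR⟩ := exists_nat_ge r
  rw [Real.closedBall_eq_Icc] at hr
  have hK : ∀ x ∈ K, -(R : ℝ) ≤ x ∧ x ≤ R := fun x hx => by
    have := hr hx
    constructor <;> linarith [this.1, this.2]
  refine Summable.of_nonneg_of_le (fun n => norm_nonneg _) (fun n => ?_)
    ((summable_intervalIntegral_int_window hi.norm R).add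
      (summable_intervalIntegral_int_window hi'.norm R))
  have hab : (n - R : ℝ) ≤ n + R + 1 := by linarith [(Nat.cast_nonneg R : (0 : ℝ) ≤ R)]
  rw [ContinuousMap.norm_le _ (add_nonneg
    (intervalIntegral.integral_nonneg hab fun u _ => norm_nonneg _)
    (intervalIntegral.integral_nonneg hab fun u _ => norm_nonneg _))]
  rintro ⟨x, hx⟩
  obtain ⟨h1, h2⟩ := hK x hx
  exact norm_le_integral_norm_add_integral_norm_deriv hd hi hi' (x := x + n) (y := n)
    (by linarith) (by linarith) (by linarith [(Nat.cast_nonneg R : (0 : ℝ) ≤ R)])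
    (by linarith [(Nat.cast_nonneg R : (0 : ℝ) ≤ R)])

theorem summable_norm_int {h h' : ℝ → ℂ} (hd : ∀ x, HasDerivAt h (h' x) x) (hi : Integrable h)
    (hi' : Integrable h') : Summable fun n : ℤ => ‖h n‖ := by
  refine Summable.of_nonneg_of_le (fun n => norm_nonneg _) (fun n => ?_)
    ((summable_intervalIntegral_int_window hi.norm 0).add
      (summable_intervalIntegral_int_window hi'.norm 0))
  exact norm_le_integral_norm_add_integral_norm_deriv hd hi hi' (y := n)
    (by simp) (by simp) (by simp) (by simp)

/-- The sampling bound is applied to `xφ`, which is differentiable everywhere, unlike possibly `φ`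
at `0`. The weight `|k|/N` is at least `1/N` except at `k = 0`, a single term. -/
theorem summable_norm_comp_div {φ : ℝ → ℂ} (hL1 : Integrable (fun x : ℝ => (x : ℂ) * φ x))
    (hA : InWienerAlgebra φ) (hdiff : ∀ x : ℝ, x ≠ 0 → DifferentiableAt ℝ φ x)
    (hdL1 : Integrable (fun x : ℝ => (x : ℂ) * deriv φ x)) {N : ℝ} (hN : 0 < N) :
    Summable fun k : ℤ => ‖φ (k / N)‖ := by
  have hφ := hA.continuous.integrable_of_integrable_id_mul hL1
  have hd := hasDerivAt_id_mul hA.continuous hdiff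
  have hs := summable_norm_int (h := fun y : ℝ => ((y / N : ℝ) : ℂ) * φ (y / N))
    (fun x => (hd (x / N)).scomp (h := fun y : ℝ => y / N) x ((hasDerivAt_id x).div_const N))
    (hL1.comp_div hN.ne') (((hφ.add hdL1).comp_div hN.ne').smul (1 / N))
  refine Summable.of_norm_bounded_eventually (hs.mul_left N) ?_
  filter_upwards [(Set.finite_singleton (0 : ℤ)).compl_mem_cofinite] with k hk
  have hk1 : (1 : ℝ) ≤ |(k : ℝ)| := by
    exact_mod_cast Int.one_le_abs (by simpa using hk)
  rw [norm_norm, norm_mul, Complex.norm_real, Real.norm_eq_abs, abs_div, abs_of_pos hN,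
    ← mul_assoc, mul_div_cancel₀ _ hN.ne']
  exact le_mul_of_one_le_left (norm_nonneg _) hk1

theorem fourier_comp_mul_left (g : ℝ → ℂ) {N : ℝ} (hN : 0 < N) (x : ℝ) :
    𝓕 (fun y : ℝ => (N : ℂ) * g (N * y)) x = 𝓕 g (x / N) := by
  rw [Real.fourier_real_eq_integral_exp_smul, Real.fourier_real_eq_integral_exp_smul]
  have key := Measure.integral_comp_mul_left
    (fun v : ℝ => Complex.exp (↑(-2 * Real.pi * v * (x / N)) * Complex.I) • g v) N
  have hN' : (N : ℂ) ≠ 0 := by exact_mod_cast hN.ne'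
  rw [abs_of_pos (by positivity), Complex.real_smul, Complex.ofReal_inv,
    eq_inv_mul_iff_mul_eq₀ hN', ← integral_const_mul] at key
  rw [← key]
  congr 1 with v
  have : -2 * Real.pi * (N * v) * (x / N) = -2 * Real.pi * v * x := by
    field_simp
  rw [this, smul_eq_mul, smul_eq_mul]
  ring

/-- Poisson summation, integrated against a periodic function. -/
theorem integral_mul_periodic_eq_tsum {h : C(ℝ, ℂ)} {h' F : ℝ → ℂ}
    (hd : ∀ x, HasDerivAt h (h' x) x) (hi : Integrable h) (hi' : Integrable h')
    (hs : Summable fun k : ℤ => ‖𝓕 (h : ℝ → ℂ) k‖) (hF : Function.Periodic F 1)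
    (hFi : IntervalIntegrable F volume 0 1) (hhF : Integrable fun y => h y * F y) :
    ∫ y, h y * F y =
      ∑' k : ℤ, 𝓕 (h : ℝ → ℂ) k * ∫ y in (0 : ℝ)..1, fourier k (y : UnitAddCircle) * F y := by
  have hK := summable_norm_restrict_comp_addRight hd hi hi'
  have hpoisson := Real.tsum_eq_tsum_fourier hK hs.of_norm
  have hsum := hhF.hasSum_intervalIntegral_comp_add_int
  have hFn : ∀ (n : ℤ) y, F (y + n) = F y := fun n y => by simpa using hF.int_mul n y
  have hFi' : Integrable F (volume.restrict (Set.Ioc 0 1)) :=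
    (intervalIntegrable_iff_integrableOn_Ioc_of_le zero_le_one).1 hFi
  have hI : (0 : ℝ) ≤ 1 := zero_le_one
  simp only [hFn, intervalIntegral.integral_of_le hI] at hsum ⊢
  -- Summable suprema of the translates of `h` over `[0, 1]` allow termwise integration against `F`,
  -- which is only integrable.
  have hleft : HasSum (fun n : ℤ => ∫ y in Set.Ioc (0 : ℝ) 1, h (y + n) * F y)
      (∫ y in Set.Ioc (0 : ℝ) 1, ∑' n : ℤ, h (y + n) * F y) := by
    let K : TopologicalSpace.Compacts ℝ := ⟨Set.Icc 0 1, isCompact_Icc⟩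
    have hle : ∀ (n : ℤ), ∀ y ∈ Set.Ioc (0 : ℝ) 1,
        ‖h (y + n)‖ ≤ ‖(h.comp (ContinuousMap.addRight (n : ℝ))).restrict K‖ := fun n y hy =>
      ((h.comp (ContinuousMap.addRight (n : ℝ))).restrict (K : Set ℝ)).norm_coe_le_norm
        ⟨y, (Set.Ioc_subset_Icc_self hy : y ∈ Set.Icc (0 : ℝ) 1)⟩
    have hint : ∀ n : ℤ, Integrable (fun y => h (y + n) * F y)
        (volume.restrict (Set.Ioc (0 : ℝ) 1)) := fun n => by
      refine hFi'.bdd_mul (c := ‖(h.comp (ContinuousMap.addRight (n : ℝ))).restrict K‖) ?_ ?_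
      · exact (h.continuous.comp (continuous_add_const (n : ℝ))).aestronglyMeasurable
      · filter_upwards [ae_restrict_mem measurableSet_Ioc] with y hy using hle n y hy
    refine hasSum_integral_of_summable_integral_norm hint ?_
    refine Summable.of_nonneg_of_le (fun n => integral_nonneg fun y => norm_nonneg _) (fun n => ?_)
      ((hK K).mul_right (∫ y in Set.Ioc (0 : ℝ) 1, ‖F y‖))
    rw [← integral_const_mul]
    refine setIntegral_mono_on (hint n).norm (hFi'.norm.const_mul _) measurableSet_Ioc fun y hy => ?_
    rw [norm_mul]
    exact mul_le_mul_of_nonneg_right (hle n y hy) (norm_nonneg _)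
  have hright : HasSum
      (fun k : ℤ => ∫ y in Set.Ioc (0 : ℝ) 1,
        𝓕 (h : ℝ → ℂ) k * (fourier k (y : UnitAddCircle) * F y))
      (∫ y in Set.Ioc (0 : ℝ) 1,
        ∑' k : ℤ, 𝓕 (h : ℝ → ℂ) k * (fourier k (y : UnitAddCircle) * F y)) := by
    have hnorm : ∀ (k : ℤ) (y : ℝ), ‖fourier k (y : UnitAddCircle)‖ = 1 := fun k y => by
      rw [fourier_apply, Circle.norm_coe]
    have hint : ∀ k : ℤ, Integrable
        (fun y : ℝ => 𝓕 (h : ℝ → ℂ) k * (fourier k (y : UnitAddCircle) * F y))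
        (volume.restrict (Set.Ioc (0 : ℝ) 1)) := fun k => by
      refine Integrable.const_mul (hFi'.bdd_mul (c := 1) ?_ ?_) _
      · exact ((map_continuous (fourier k)).comp
          (AddCircle.continuous_mk' (1 : ℝ))).aestronglyMeasurable
      · exact ae_of_all _ fun y => (hnorm k y).le
    refine hasSum_integral_of_summable_integral_norm hint ?_
    simp_rw [norm_mul, hnorm, one_mul, integral_const_mul]
    exact hs.mul_right _
  rw [hsum.unique hleft]
  simp only [integral_const_mul] at hright
  rw [hright.tsum_eq]
  refine integral_congr_ae (ae_of_all _ fun y => ?_)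
  simp only [tsum_mul_right, hpoisson, ← mul_assoc]

/-! ### Periodic functions, Fourier coefficients and `d`-points -/

theorem InL1Torus.intervalIntegrable {f : ℝ → ℂ} (hf : InL1Torus f) (a b : ℝ) :
    IntervalIntegrable f volume a b :=
  hf.1.intervalIntegrable (by positivity) (t := -Real.pi)
    (by rw [show -Real.pi + 2 * Real.pi = Real.pi by ring]; exact hf.2) a b

theorem InL1Torus.intervalIntegrable_comp {f : ℝ → ℂ} (hf : InL1Torus f) (x a b : ℝ) :
    IntervalIntegrable (fun y => f (x + 2 * Real.pi * y)) volume a b := by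
  have hpi : (2 * Real.pi) ≠ 0 := by positivity
  have := ((hf.intervalIntegrable (x + 2 * Real.pi * a) (x + 2 * Real.pi * b)).comp_add_left
    x).comp_mul_left (c := 2 * Real.pi)
  rwa [add_sub_cancel_left, add_sub_cancel_left, mul_div_cancel_left₀ _ hpi,
    mul_div_cancel_left₀ _ hpi] at this

theorem InL1Torus.periodic_comp {f : ℝ → ℂ} (hf : InL1Torus f) (x : ℝ) :
    Function.Periodic (fun y => f (x + 2 * Real.pi * y)) 1 := fun y => by
  beta_reduce
  rw [mul_add, mul_one, ← add_assoc, hf.1]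

/-- Substitute `t = x + 2πy` and shift the period; the character `e^{2πiky}` carries the sign
opposite to that in `torusCoeff`, hence `-k`. -/
theorem integral_fourier_mul_eq_torusCoeff {f : ℝ → ℂ} (hf : InL1Torus f) (x : ℝ) (k : ℤ) :
    ∫ y in (0 : ℝ)..1, fourier k (y : UnitAddCircle) * f (x + 2 * Real.pi * y) =
      torusCoeff f (-k) * Complex.exp (Complex.I * ((-k : ℤ) : ℂ) * x) := by
  have hpi : (2 * Real.pi) ≠ 0 := by positivity
  set g : ℝ → ℂ := fun t => f t * Complex.exp (-(Complex.I * ((-k : ℤ) : ℂ) * (t : ℂ))) with hg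
  have hgp : Function.Periodic g (2 * Real.pi) := fun t => by
    simp only [hg, hf.1 t]
    congr 1
    rw [Complex.exp_eq_exp_iff_exists_int]
    exact ⟨k, by push_cast; ring⟩
  have h1 : ∀ y : ℝ, fourier k (y : UnitAddCircle) * f (x + 2 * Real.pi * y) =
      g (x + 2 * Real.pi * y) * Complex.exp (Complex.I * ((-k : ℤ) : ℂ) * x) := fun y => by
    simp only [hg]
    rw [fourier_coe_apply, mul_comm (Complex.exp _), mul_assoc (f _), ← Complex.exp_add]
    congr 2
    push_cast
    ring
  simp_rw [h1]
  rw [intervalIntegral.integral_mul_const, intervalIntegral.integral_comp_add_mul g hpi,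
    mul_zero, mul_one, add_zero, hgp.intervalIntegral_add_eq x (-Real.pi),
    show -Real.pi + 2 * Real.pi = Real.pi by ring, Complex.real_smul, torusCoeff]
  simp only [hg]
  push_cast
  rw [one_div]

theorem norm_torusCoeff_le (f : ℝ → ℂ) (k : ℤ) :
    ‖torusCoeff f k‖ ≤ 1 / (2 * Real.pi) * ∫ t in (-Real.pi)..Real.pi, ‖f t‖ := by
  have hle : -Real.pi ≤ Real.pi := by linarith [Real.pi_pos]
  rw [torusCoeff, norm_mul]
  have h1 : ‖(1 / (2 * (Real.pi : ℂ)))‖ = 1 / (2 * Real.pi) := by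
    simp [abs_of_pos Real.pi_pos]
  rw [h1]
  refine mul_le_mul_of_nonneg_left ?_ (by positivity)
  refine (intervalIntegral.norm_integral_le_integral_norm hle).trans_eq ?_
  congr 1 with t
  have : -(Complex.I * (k : ℂ) * (t : ℂ)) = ((-(k * t) : ℝ) : ℂ) * Complex.I := by
    push_cast; ring
  rw [norm_mul, this, Complex.norm_exp_ofReal_mul_I, mul_one]

theorem summable_meanTerm {φ : ℝ → ℂ} {n : ℕ} (hs : Summable fun k : ℤ => ‖φ (k / (n + 1 : ℝ))‖)
    (f : ℝ → ℂ) (x : ℝ) : Summable (meanTerm φ f n x) := by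
  refine Summable.of_norm_bounded
    (hs.mul_right (1 / (2 * Real.pi) * ∫ t in (-Real.pi)..Real.pi, ‖f t‖)) fun k => ?_
  have : Complex.I * (k : ℂ) * (x : ℂ) = ((k * x : ℝ) : ℂ) * Complex.I := by push_cast; ring
  rw [meanTerm, norm_mul, norm_mul, this, Complex.norm_exp_ofReal_mul_I, mul_one]
  exact mul_le_mul_of_nonneg_left (norm_torusCoeff_le f k) (norm_nonneg _)

theorem IsDPoint.hasDerivAt_integral_comp_sub {f : ℝ → ℂ} (hf : InL1Torus f) {x : ℝ} {d : ℂ}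
    (h : IsDPoint f x d) :
    HasDerivAt (fun y => ∫ u in (0 : ℝ)..y, (f (x + 2 * Real.pi * u) - d)) 0 0 := by
  have hpi : (2 * Real.pi) ≠ 0 := by positivity
  have heq : (fun y => ∫ u in (0 : ℝ)..y, (f (x + 2 * Real.pi * u) - d)) = fun y : ℝ =>
      (2 * Real.pi)⁻¹ • ((∫ t in (0 : ℝ)..(x + 2 * Real.pi * y), f t) - ∫ t in (0 : ℝ)..x, f t)
        - y • d := by
    ext y
    rw [intervalIntegral.integral_sub (hf.intervalIntegrable_comp x 0 y) intervalIntegrable_const,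
      intervalIntegral.integral_comp_add_mul f hpi, intervalIntegral.integral_const, sub_zero,
      mul_zero, add_zero, intervalIntegral.integral_interval_sub_left
        (hf.intervalIntegrable _ _) (hf.intervalIntegrable _ _)]
  rw [heq]
  have hin : HasDerivAt (fun y : ℝ => x + 2 * Real.pi * y) (2 * Real.pi) 0 := by
    simpa using ((hasDerivAt_id (0 : ℝ)).const_mul (2 * Real.pi)).const_add x
  have hF : HasDerivAt (fun y : ℝ => ∫ t in (0 : ℝ)..y, f t) d (x + 2 * Real.pi * 0) := by
    simpa using! h
  have := ((((hF.scomp (0 : ℝ) hin).sub_const (∫ t in (0 : ℝ)..x, f t)).const_smul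
    (2 * Real.pi)⁻¹).sub ((hasDerivAt_id (0 : ℝ)).smul_const d))
  rw [smul_smul, inv_mul_cancel₀ hpi, one_smul, sub_self] at this
  exact this

/-! ### The means as integrals, and the conclusion -/

/-- The linear mean as a convolution of `f` with the dilated kernel `G`. -/
theorem tsum_meanTerm_eq_integral {φ f G G' : ℝ → ℂ} {n : ℕ} {x : ℝ}
    (hs : Summable fun k : ℤ => ‖φ (k / (n + 1 : ℝ))‖)
    (hG : ∀ y, HasDerivAt G (G' y) y) (hGi : Integrable G) (hG'i : Integrable G')
    (hGφ : ∀ x, 𝓕 G x = φ (-x)) (hf : InL1Torus f)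
    (hfi : Integrable fun u => G u * f (x + 2 * Real.pi * (u / (n + 1)))) :
    ∑' k : ℤ, meanTerm φ f n x k = ∫ u, G u * f (x + 2 * Real.pi * (u / (n + 1))) := by
  have hN : (0 : ℝ) < n + 1 := by positivity
  have hne : (n + 1 : ℝ) ≠ 0 := hN.ne'
  have hd : ∀ y : ℝ, HasDerivAt (fun y : ℝ => ((n + 1 : ℝ) : ℂ) * G ((n + 1) * y))
      (((n + 1 : ℝ) : ℂ) * ((n + 1 : ℝ) • G' ((n + 1) * y))) y := fun y => by
    have hin : HasDerivAt (fun y : ℝ => (n + 1 : ℝ) * y) (n + 1) y := by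
      simpa using (hasDerivAt_id y).const_mul (n + 1 : ℝ)
    exact ((hG ((n + 1) * y)).scomp (h := fun y : ℝ => (n + 1 : ℝ) * y) y hin).const_mul _
  -- The dilation `N G(Ny)` has the transform `φ(-k/N)` at the integer `k`.
  obtain ⟨h, hh⟩ : ∃ h : C(ℝ, ℂ),
      (h : ℝ → ℂ) = fun y : ℝ => ((n + 1 : ℝ) : ℂ) * G ((n + 1) * y) :=
    ⟨⟨_, continuous_iff_continuousAt.2 fun y => (hd y).continuousAt⟩, rfl⟩
  have hFh : ∀ k : ℤ, 𝓕 (h : ℝ → ℂ) k = φ ((-k : ℤ) / (n + 1 : ℝ)) := fun k => by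
    rw [hh, fourier_comp_mul_left G hN k, hGφ, Int.cast_neg, neg_div]
  have hscale : ∀ y : ℝ, h y * f (x + 2 * Real.pi * y) = ((n + 1 : ℝ) : ℂ) *
      (fun u => G u * f (x + 2 * Real.pi * (u / (n + 1)))) ((n + 1) * y) := fun y => by
    simp only [hh, mul_div_cancel_left₀ _ hne, mul_assoc]
  have key := integral_mul_periodic_eq_tsum (h := h) (by rw [hh]; exact hd)
    (by rw [hh]; exact (hGi.comp_mul_left' hne).const_mul _)
    (((hG'i.comp_mul_left' hne).smul (n + 1 : ℝ)).const_mul ((n + 1 : ℝ) : ℂ))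
    (by simp_rw [hFh]; exact (Equiv.neg ℤ).summable_iff.2 hs) (hf.periodic_comp x)
    (hf.intervalIntegrable_comp x 0 1)
    (by simp_rw [hscale]; exact (hfi.comp_mul_left' hne).const_mul _)
  rw [integral_congr_ae (ae_of_all _ hscale), integral_const_mul,
    Measure.integral_comp_mul_left (fun u => G u * f (x + 2 * Real.pi * (u / (n + 1))))
      (n + 1 : ℝ), abs_of_pos (by positivity),
    Complex.real_smul, Complex.ofReal_inv,
    mul_inv_cancel_left₀ (by exact_mod_cast hne)] at key
  rw [key, ← (Equiv.neg ℤ).tsum_eq]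
  refine tsum_congr fun k => ?_
  rw [integral_fourier_mul_eq_torusCoeff hf, hFh, meanTerm, ← mul_assoc, Equiv.neg_apply]

theorem theorem2 (φ : ℝ → ℂ)
    (hBV : ∃ δ : ℝ, 0 < δ ∧ BoundedVariationOn φ (Set.Icc (-δ) δ))
    (h0 : φ 0 = 1)
    (hL1 : Integrable (fun x : ℝ => (x : ℂ) * φ x) volume)
    (hA : InWienerAlgebra φ)
    (hdiff : ∀ x : ℝ, x ≠ 0 → DifferentiableAt ℝ φ x)
    (hdA : InWienerAlgebra (fun x : ℝ => (x : ℂ) * deriv φ x))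
    (hdL1 : Integrable (fun x : ℝ => (x : ℂ) * deriv φ x) volume) :
    ∀ f : ℝ → ℂ, InL1Torus f → ∀ (x : ℝ) (d : ℂ), IsDPoint f x d →
      (∀ n : ℕ, Summable (meanTerm φ f n x)) ∧
        Tendsto (fun n : ℕ => ∑' k : ℤ, meanTerm φ f n x k) atTop (𝓝 d) := by
  intro f hf x d hx
  have hN : ∀ n : ℕ, (0 : ℝ) < n + 1 := fun n => by positivity
  have hs : ∀ n : ℕ, Summable fun k : ℤ => ‖φ (k / (n + 1 : ℝ))‖ := fun n =>
    summable_norm_comp_div hL1 hA hdiff hdL1 (hN n)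
  refine ⟨fun n => summable_meanTerm (hs n) f x, ?_⟩
  have hφ := hA.continuous.integrable_of_integrable_id_mul hL1
  have hGi := hA.integrable_fourier hφ
  set G : ℝ → ℂ := 𝓕 φ
  set G' : ℝ → ℂ := 𝓕 (fun x : ℝ => (-2 * Real.pi * Complex.I * x) • φ x)
  have hG : ∀ y, HasDerivAt G (G' y) y := Real.hasDerivAt_fourier hφ (by simpa using! hL1)
  have hG'c : Continuous G' := continuous_fourier <| by
    simpa [mul_assoc] using! hL1.const_mul (-2 * Real.pi * Complex.I)
  have hG'I : Integrable fun y : ℝ => (y : ℂ) * G' y :=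
    integrable_id_mul_deriv_fourier hL1 hA hdiff hdA hdL1
  have hG'i : Integrable G' := hG'c.integrable_of_integrable_id_mul hG'I
  -- The integral of `G` is `𝓕 (𝓕 φ) 0 = φ 0`.
  have hGone : ∫ u, G u = 1 := by
    have := fourier_fourier_eq hA hφ 0
    rw [neg_zero, h0, Real.fourier_real_eq_integral_exp_smul] at this
    simpa using this
  obtain ⟨hqi, hqlim⟩ := tendsto_integral_mul_periodic
    (q := fun v => f (x + 2 * Real.pi * v) - d) hG hG'c hG'I (Real.zero_at_infty_fourier φ)
    (fun v => congrArg (· - d) (hf.periodic_comp x v))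
    (fun a b => (hf.intervalIntegrable_comp x a b).sub intervalIntegrable_const)
    (hx.hasDerivAt_integral_comp_sub hf)
  have hfi : ∀ n : ℕ, Integrable fun u => G u * f (x + 2 * Real.pi * (u / (n + 1))) := fun n => by
    refine ((hqi n).add (hGi.mul_const d)).congr (ae_of_all _ fun u => ?_)
    simp only [Pi.add_apply]
    ring
  have hmean : ∀ n : ℕ, ∑' k : ℤ, meanTerm φ f n x k =
      ∫ u, G u * f (x + 2 * Real.pi * (u / (n + 1))) := fun n =>
    tsum_meanTerm_eq_integral (hs n) hG hGi hG'i (fourier_fourier_eq hA hφ) hf (hfi n)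
  have hlim := hqlim.add_const d
  rw [zero_add] at hlim
  refine hlim.congr fun n => ?_
  rw [hmean]
  have hsplit : ∀ u, G u * f (x + 2 * Real.pi * (u / (n + 1))) =
      G u * (f (x + 2 * Real.pi * (u / (n + 1))) - d) + G u * d := fun u => by ring
  simp_rw [hsplit]
  rw [integral_add (hqi n) (hGi.mul_const d), integral_mul_const, hGone, one_mul]
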